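/- Let $n\geq 1$ be an integer and let $a<b$ be real numbers. Let $U_n$ be the Chebyshev polynomial of the second kind and put $$\phi_n(x)=\frac{(b-a)^n}{2^{2n}}\,U_n\!\left(\frac{2x-a-b}{b-a}\right).$$ Let $f:[a,b]\to\mathbb{R}$ be such that $f^{(n-1)}$ exists and is absolutely continuous on $[a,b]$ (derivatives at the endpoints being one-sided) and $f^{(n)}\in L^\infty([a,b])$, and put $$E_n(f)=\frac{(-1)^n}{n!}\int_a^b f^{(n)}(x)\,\phi_n(x)\,dx.$$ Then $$\int_a^b f(x)\,dx=\frac1{n!}\sum_{k=0}^{n-1}\frac{(b-a)^{k+1}(2n-k)!\,(n-k-1)!}{2^{2k+2}(2n-2k-1)!\,(k+1)!}\left[f^{(k)}(a)+(-1)^kf^{(k)}(b)\right]+E_n(f),$$ and $$|E_n(f)|\leq\frac{(b-a)^{n+1}}{2^{2n}\,n!}\,\|f^{(n)}\|_\infty ,$$ where $\|\cdot\|_\infty$ is the essential supremum norm on $[a,b]$. The estimate is sharp in the sense that the coefficient of $\|f^{(n)}\|_\infty$ cannot be reduced: for fixed $n,a,b$, if $C$ is a real number such that $|E_n(f)|\leq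 C\,\|f^{(n)}\|_\infty$ for all such $f$, then $C\geq \frac{(b-a)^{n+1}}{2^{2n}\,n!}$. -/

import Mathlib

open MeasureTheory

noncomputable section

namespace ChebyshevQuadrature

/-- The `k`-th derivative of `f` on `[a,b]` (one-sided at the endpoints). When `f^{(k-1)}` is
absolutely continuous on `[a,b]` this is its derivative at almost every point of `[a,b]`
(and `0` on the null set where that derivative does not exist). -/
def D (k : ℕ) (a b : ℝ) (f : ℝ → ℝ) : ℝ → ℝ :=
  iteratedDerivWithin k f (Set.Icc a b)

/-- `f^{(n-1)}` exists on `[a,b]` and is absolutely continuous, and `f^{(n)} ∈ L^∞([a,b])`. -/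
structure Admissible (n : ℕ) (a b : ℝ) (f : ℝ → ℝ) : Prop where
  contDiffOn : ContDiffOn ℝ ((n - 1 : ℕ) : ℕ∞) f (Set.Icc a b)
  absolutelyContinuous : AbsolutelyContinuousOnInterval (D (n - 1) a b f) a b
  memLp : MemLp (D n a b f) ⊤ (volume.restrict (Set.Icc a b))

/-- `‖f^{(n)}‖_∞`, the essential supremum of `|f^{(n)}|` over `[a,b]`. -/
def supNormD (n : ℕ) (a b : ℝ) (f : ℝ → ℝ) : ℝ :=
  (eLpNorm (D n a b f) ⊤ (volume.restrict (Set.Icc a b))).toReal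

/-- The monic polynomial `((b-a)/2)^n 2^{-n} U_n((2x-a-b)/(b-a))`, with `U_n` the Chebyshev
polynomial of the second kind. -/
def phi (n : ℕ) (a b x : ℝ) : ℝ :=
  ((b - a) / 2) ^ n *
    ((2 : ℝ) ^ n)⁻¹ * (Polynomial.Chebyshev.U ℝ (n : ℤ)).eval ((2 * x - a - b) / (b - a))

/-- The quadrature rule. -/
def rule (n : ℕ) (a b : ℝ) (f : ℝ → ℝ) : ℝ :=
  1 / (n.factorial : ℝ) * ∑ k ∈ Finset.range n,
    ((b - a) ^ (k + 1) * ((2 * n - k).factorial : ℝ) * ((n - k - 1).factorial : ℝ) /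
      ((2 : ℝ) ^ (2 * k + 2) * ((2 * n - 2 * k - 1).factorial : ℝ) * ((k + 1).factorial : ℝ))) *
    (D k a b f a + (-1) ^ k * D k a b f b)

/-- The error term `E_n(f)`. -/
def errorTerm (n : ℕ) (a b : ℝ) (f : ℝ → ℝ) : ℝ :=
  (-1) ^ n / (n.factorial : ℝ) * ∫ x in a..b, D n a b f x * phi n a b x

end ChebyshevQuadrature

end

/-!
Repeated integration by parts against a monic polynomial `p` of degree `n` turns
`n! * ∫ f = ∫ f * p⁽ⁿ⁾` into boundary terms plus `(-1)ⁿ * ∫ f⁽ⁿ⁾ * p`, so every such `p` gives a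
quadrature rule. For the rescaled Chebyshev polynomial `φₙ` the values of the derivatives at `b`
are explicit, and those at `a` follow by parity.

The best constant in the error estimate is `(∫ |p|) / n!`: the bound is the duality between `L¹`
and `L^∞`, and it is attained by an `n`-fold primitive of the sign of `p`. For `φₙ` the
substitution `x = cos θ` reduces `∫ |φₙ|` to `∫ |sin ((n + 1) θ)| = 2` over `[0, π]`.
-/

namespace ChebyshevQuadrature

open Polynomial

/-! ### Derivatives of Chebyshev polynomials -/

theorem iterate_derivative_natDegree {R : Type*} [Semiring R] (p : R[X]) :
    derivative^[p.natDegree] p = C (p.natDegree.factorial • p.leadingCoeff) := by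
  rw [← factorial_smul_hasseDeriv, LinearMap.smul_apply, hasseDeriv_natDegree_eq_C, smul_C]

theorem iterate_derivative_comp_C_mul_X_add_C {R : Type*} [CommSemiring R] (p : R[X]) (c d : R)
    (k : ℕ) :
    derivative^[k] (p.comp (C c * X + C d)) =
      C (c ^ k) * (derivative^[k] p).comp (C c * X + C d) := by
  induction k with
  | zero => simp
  | succ k ih =>
    rw [Function.iterate_succ_apply', ih, Function.iterate_succ_apply', derivative_C_mul,
      derivative_comp, pow_succ, C_mul]
    simp only [derivative_add, derivative_C_mul, derivative_X, derivative_C]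
    ring

theorem U_comp_neg_X (R : Type*) [CommRing R] (n : ℕ) :
    (Chebyshev.U R n).comp (-X) = C ((-1) ^ n) * Chebyshev.U R n := by
  rw [comp_eq_aeval, Chebyshev.aeval_U, Chebyshev.U_eval_neg, ← Chebyshev.aeval_U (R := R),
    aeval_X_left_apply]
  simp [Int.negOnePow_def]

theorem iterate_derivative_U_eval_neg {R : Type*} [CommRing R] (n k : ℕ) (x : R) :
    (derivative^[k] (Chebyshev.U R n)).eval (-x) =
      (-1) ^ (n + k) * (derivative^[k] (Chebyshev.U R n)).eval x := by
  have hcomp : derivative^[k] ((Chebyshev.U R n).comp (-X)) =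
      C ((-1) ^ k) * (derivative^[k] (Chebyshev.U R n)).comp (-X) := by
    simpa using iterate_derivative_comp_C_mul_X_add_C (Chebyshev.U R n) (-1) 0 k
  have heval := congrArg (eval x) hcomp
  simp only [U_comp_neg_X, iterate_derivative_C_mul, eval_mul, eval_C, eval_comp, eval_neg,
    eval_X] at heval
  rw [pow_add, mul_right_comm, heval, mul_right_comm, ← mul_pow]
  simp

theorem iterate_derivative_U_eval_one_eq_factorial {F : Type*} [Field F] [CharZero F] {n k : ℕ}
    (hk : k ≤ n) :
    (derivative^[k] (Chebyshev.U F n)).eval 1 =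
      2 ^ k * k.factorial * (n + 1 + k).factorial /
        ((2 * k + 1).factorial * (n - k).factorial) := by
  have factorial_ne_zero (m : ℕ) : (m.factorial : F) ≠ 0 := Nat.cast_ne_zero.2 m.factorial_ne_zero
  induction k with
  | zero =>
    have := factorial_ne_zero n
    simp only [Function.iterate_zero, id_eq, Chebyshev.U_eval_one, Int.cast_natCast, pow_zero,
      Nat.factorial_zero, Nat.cast_one, mul_one, add_zero, Nat.factorial_succ, Nat.cast_mul,
      Nat.cast_add, one_mul, mul_zero, zero_add, tsub_zero]
    field_simp
  | succ k ih =>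
    have hrec := Chebyshev.iterate_derivative_U_eval_one_recurrence (R := F) n k
    rw [ih (by omega)] at hrec
    obtain ⟨l, rfl⟩ : ∃ l, n = k + 1 + l := ⟨n - (k + 1), by omega⟩
    rw [show k + 1 + l - k = l + 1 by omega] at hrec
    rw [show k + 1 + l - (k + 1) = l by omega, show 2 * (k + 1) + 1 = 2 * k + 1 + 1 + 1 by ring,
      ← add_assoc (k + 1 + l + 1) k 1]
    have h3 : 2 * (k : F) + 3 ≠ 0 := by exact_mod_cast (2 * k + 2).succ_ne_zero
    have hk' : (k : F) + 1 ≠ 0 := by exact_mod_cast k.succ_ne_zero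
    have hl : (l : F) + 1 ≠ 0 := by exact_mod_cast l.succ_ne_zero
    have := factorial_ne_zero l
    have := factorial_ne_zero (2 * k + 1)
    apply mul_left_cancel₀ h3
    rw [hrec]
    simp only [Nat.factorial_succ (2 * k + 1 + 1), Nat.factorial_succ (2 * k + 1),
      Nat.factorial_succ l, Nat.factorial_succ k, Nat.factorial_succ (k + 1 + l + 1 + k)]
    push_cast
    rw [show 2 * (k : F) + 1 + 1 + 1 = 2 * k + 3 by ring,
      show 2 * (k : F) + 1 + 1 = 2 * (k + 1) by ring]
    rw [mul_comm] at h3 -- the form in which `field_simp` meets this denominator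
    field_simp
    ring

/-! ### The Chebyshev kernel -/

/-- The kernel `phi n a b` as a polynomial, whose derivatives are the successive kernels in the
repeated integration by parts. -/
noncomputable def phiPoly (n : ℕ) (a b : ℝ) : ℝ[X] :=
  C (((b - a) / 4) ^ n) *
    (Chebyshev.U ℝ n).comp (C (2 / (b - a)) * X + C (-(a + b) / (b - a)))

section phiPoly

variable (n : ℕ) {a b : ℝ}

theorem iterate_derivative_phiPoly_eval (a b : ℝ) (j : ℕ) (x : ℝ) :
    (derivative^[j] (phiPoly n a b)).eval x =
      ((b - a) / 4) ^ n * (2 / (b - a)) ^ j *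
        (derivative^[j] (Chebyshev.U ℝ n)).eval ((2 * x - a - b) / (b - a)) := by
  rw [phiPoly, iterate_derivative_C_mul, iterate_derivative_comp_C_mul_X_add_C]
  simp only [eval_mul, eval_C, eval_comp, eval_add, eval_X]
  rw [show 2 / (b - a) * x + -(a + b) / (b - a) = (2 * x - a - b) / (b - a) by ring, mul_assoc]

theorem phi_eq_mul_U_eval (a b x : ℝ) :
    phi n a b x = ((b - a) / 4) ^ n * (Chebyshev.U ℝ n).eval ((2 * x - a - b) / (b - a)) := by
  rw [phi, ← inv_pow, ← mul_pow, show (b - a) / 2 * 2⁻¹ = (b - a) / 4 by ring]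

theorem phiPoly_eval (a b x : ℝ) : (phiPoly n a b).eval x = phi n a b x := by
  simpa [phi_eq_mul_U_eval] using iterate_derivative_phiPoly_eval n a b 0 x

theorem continuous_phi (a b : ℝ) : Continuous (phi n a b) := by
  simpa only [phiPoly_eval] using (phiPoly n a b).continuous

theorem natDegree_phiPoly (hab : a ≠ b) : (phiPoly n a b).natDegree = n := by
  have : b - a ≠ 0 := sub_ne_zero.2 hab.symm
  rw [phiPoly, natDegree_C_mul (by positivity), natDegree_comp, Chebyshev.natDegree_U_natCast,
    natDegree_linear (by positivity), mul_one]

theorem monic_phiPoly (hab : a ≠ b) : (phiPoly n a b).Monic := by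
  have hba : b - a ≠ 0 := sub_ne_zero.2 hab.symm
  have hslope : 2 / (b - a) ≠ 0 := by positivity
  rw [Monic, phiPoly, leadingCoeff_mul, leadingCoeff_C,
    leadingCoeff_comp (by rw [natDegree_linear hslope]; exact one_ne_zero),
    leadingCoeff_linear hslope, Chebyshev.leadingCoeff_U_natCast, Chebyshev.natDegree_U_natCast,
    ← mul_pow, ← mul_pow, show (b - a) / 4 * (2 * (2 / (b - a))) = 1 by field_simp; norm_num,
    one_pow]

theorem iterate_derivative_phiPoly_eval_left (a b : ℝ) (j : ℕ) :
    (derivative^[j] (phiPoly n a b)).eval a =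
      (-1) ^ (n + j) * (derivative^[j] (phiPoly n a b)).eval b := by
  rw [iterate_derivative_phiPoly_eval, iterate_derivative_phiPoly_eval,
    show (2 * a - a - b) / (b - a) = -((2 * b - a - b) / (b - a)) by ring,
    iterate_derivative_U_eval_neg]
  ring

variable {n}

theorem iterate_derivative_phiPoly_eval_right (hab : a ≠ b) {k : ℕ} (hk : k < n) :
    (derivative^[n - 1 - k] (phiPoly n a b)).eval b =
      (b - a) ^ (k + 1) * (2 * n - k).factorial * (n - k - 1).factorial /
        (2 ^ (2 * k + 2) * (2 * n - 2 * k - 1).factorial * (k + 1).factorial) := by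
  have hba : b - a ≠ 0 := sub_ne_zero.2 hab.symm
  obtain ⟨m, rfl⟩ : ∃ m, n = m + k + 1 := ⟨n - k - 1, by omega⟩
  rw [iterate_derivative_phiPoly_eval, show 2 * b - a - b = b - a by ring, div_self hba,
    show m + k + 1 - 1 - k = m by omega,
    iterate_derivative_U_eval_one_eq_factorial (by omega),
    show 2 * (m + k + 1) - k = m + k + 1 + 1 + m by omega,
    show m + k + 1 - k - 1 = m by omega, show 2 * (m + k + 1) - 2 * k - 1 = 2 * m + 1 by omega,
    show m + k + 1 - m = k + 1 by omega, show (4 : ℝ) = 2 ^ 2 by norm_num, div_pow, div_pow,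
    ← pow_mul]
  field_simp
  ring

end phiPoly

/-! ### The `L¹` norm of the kernel -/

theorem integral_abs_sin_zero_int_mul_pi (m : ℤ) :
    ∫ x in (0 : ℝ)..m * Real.pi, |Real.sin x| = 2 * m := by
  have hper : Function.Periodic (fun x => |Real.sin x|) Real.pi := fun x => by
    simp only [Real.sin_add_pi, abs_neg]
  have hperiod : ∫ x in (0 : ℝ)..Real.pi, |Real.sin x| = 2 := by
    rw [intervalIntegral.integral_congr (g := Real.sin) fun x hx => ?_, integral_sin]
    · norm_num
    · rw [Set.uIcc_of_le Real.pi_pos.le] at hx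
      exact abs_of_nonneg (Real.sin_nonneg_of_mem_Icc hx)
  have h := hper.intervalIntegral_add_zsmul_eq m 0
    fun t s => Real.continuous_sin.abs.intervalIntegrable t s
  simp only [zero_add, hperiod, zsmul_eq_mul] at h
  rw [h, mul_comm]

theorem integral_abs_sin_int_mul {m : ℤ} (hm : m ≠ 0) :
    ∫ θ in (0 : ℝ)..Real.pi, |Real.sin (m * θ)| = 2 := by
  have hm' : (m : ℝ) ≠ 0 := Int.cast_ne_zero.2 hm
  rw [intervalIntegral.integral_comp_mul_left (fun x => |Real.sin x|) hm', mul_zero,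
    integral_abs_sin_zero_int_mul_pi, smul_eq_mul]
  field_simp

theorem integral_eq_integral_comp_cos_mul_sin {g : ℝ → ℝ} (hg : Continuous g) :
    ∫ x in (-1 : ℝ)..1, g x = ∫ θ in (0 : ℝ)..Real.pi, g (Real.cos θ) * Real.sin θ := by
  have h := intervalIntegral.integral_comp_mul_deriv (a := Real.pi) (b := 0)
    (fun θ _ => Real.hasDerivAt_cos θ) Real.continuous_sin.neg.continuousOn hg
  rw [Real.cos_pi, Real.cos_zero] at h
  rw [← h, intervalIntegral.integral_symm, ← intervalIntegral.integral_neg]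
  simp only [Function.comp_apply, mul_neg, neg_neg]

theorem integral_abs_U {n : ℤ} (hn : n ≠ -1) :
    ∫ x in (-1 : ℝ)..1, |(Chebyshev.U ℝ n).eval x| = 2 := by
  rw [integral_eq_integral_comp_cos_mul_sin (Chebyshev.U ℝ n).continuous.abs,
    ← integral_abs_sin_int_mul (m := n + 1) (by omega)]
  refine intervalIntegral.integral_congr fun θ hθ => ?_
  rw [Set.uIcc_of_le Real.pi_pos.le] at hθ
  push_cast
  rw [← Chebyshev.U_real_cos, abs_mul, abs_of_nonneg (Real.sin_nonneg_of_mem_Icc hθ)]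

theorem integral_abs_phi (n : ℕ) {a b : ℝ} (hab : a < b) :
    ∫ x in a..b, |phi n a b x| = (b - a) ^ (n + 1) / 2 ^ (2 * n) := by
  have hba : 0 < b - a := sub_pos.2 hab
  have haffine (x : ℝ) :
      (2 * x - a - b) / (b - a) = 2 / (b - a) * x + -(a + b) / (b - a) := by ring
  simp only [phi_eq_mul_U_eval, haffine, abs_mul, abs_of_pos (pow_pos (div_pos hba four_pos) n)]
  rw [intervalIntegral.integral_const_mul,
    intervalIntegral.integral_comp_mul_add (fun x => |(Chebyshev.U ℝ n).eval x|) (by positivity),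
    ← haffine, ← haffine, show (2 * a - a - b) / (b - a) = -1 by field_simp; ring,
    show (2 * b - a - b) / (b - a) = 1 by field_simp; ring, integral_abs_U (by omega), smul_eq_mul,
    div_pow, pow_mul, show (2 : ℝ) ^ 2 = 4 by norm_num]
  field_simp
  ring

/-! ### Integration by parts -/

section IntegrationByParts

variable {n : ℕ} {a b : ℝ} {f : ℝ → ℝ}

theorem deriv_D {k : ℕ} {x : ℝ} (hx : x ∈ Set.Ioo a b) :
    deriv (D k a b f) x = D (k + 1) a b f x := by
  rw [D, D, iteratedDerivWithin_succ, derivWithin_of_mem_nhds (Icc_mem_nhds hx.1 hx.2)]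

theorem absolutelyContinuousOnInterval_eval (p : ℝ[X]) (a b : ℝ) :
    AbsolutelyContinuousOnInterval (fun x => p.eval x) a b :=
  ContDiffOn.absolutelyContinuousOnInterval <| ContDiff.contDiffOn <| by
    simpa only [coe_aeval_eq_eval] using p.contDiff_aeval (𝕜 := ℝ) 1

theorem integral_D_mul_derivative (hab : a ≤ b) {k : ℕ}
    (hf : AbsolutelyContinuousOnInterval (D k a b f) a b) (p : ℝ[X]) :
    ∫ x in a..b, D k a b f x * (derivative p).eval x =
      D k a b f b * p.eval b - D k a b f a * p.eval a -
        ∫ x in a..b, D (k + 1) a b f x * p.eval x := by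
  have h := hf.integral_mul_deriv_eq_deriv_mul (absolutelyContinuousOnInterval_eval p a b)
  simp only [Polynomial.deriv] at h
  rw [h]
  congr 1
  refine intervalIntegral.integral_congr_uIoo fun x hx => ?_
  rw [Set.uIoo_of_le hab] at hx
  simp only [deriv_D hx]

theorem integral_mul_iterate_derivative (hab : a ≤ b)
    (hf : ∀ k < n, AbsolutelyContinuousOnInterval (D k a b f) a b) (p : ℝ[X]) :
    ∫ x in a..b, f x * (derivative^[n] p).eval x =
      ∑ k ∈ Finset.range n, (-1) ^ k *
        (D k a b f b * (derivative^[n - 1 - k] p).eval b -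
          D k a b f a * (derivative^[n - 1 - k] p).eval a) +
      (-1) ^ n * ∫ x in a..b, D n a b f x * p.eval x := by
  induction n generalizing p with
  | zero => simp [D]
  | succ n ih =>
    have hshift : ∀ k ∈ Finset.range n,
        derivative^[n - 1 - k] (derivative p) = derivative^[n + 1 - 1 - k] p := fun k hk => by
      rw [← Function.iterate_succ_apply]
      congr 1
      have := Finset.mem_range.1 hk
      omega
    rw [Function.iterate_succ_apply, ih (fun k hk => hf k (by omega)) (derivative p),
      integral_D_mul_derivative hab (hf n n.lt_succ_self), Finset.sum_range_succ,
      Finset.sum_congr rfl fun k hk => by rw [hshift k hk], Nat.add_sub_cancel, Nat.sub_self,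
      Function.iterate_zero_apply]
    ring

theorem Admissible.absolutelyContinuousOnInterval_D (hab : a < b) (hf : Admissible n a b f)
    {k : ℕ} (hk : k < n) : AbsolutelyContinuousOnInterval (D k a b f) a b := by
  rcases (Nat.le_sub_one_of_lt hk).eq_or_lt with rfl | hlt
  · exact hf.absolutelyContinuous
  · have hsucc : ContDiffOn ℝ (k + 1 : ℕ) f (Set.Icc a b) :=
      hf.contDiffOn.of_le (by exact_mod_cast hlt)
    apply ContDiffOn.absolutelyContinuousOnInterval
    rw [Set.uIcc_of_le hab.le]
    exact ((contDiffOn_nat_succ_iff_contDiffOn_one_iteratedDerivWithin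
      (uniqueDiffOn_Icc hab)).1 hsucc).2

theorem Admissible.factorial_mul_integral_eq_of_monic (hab : a < b) (hf : Admissible n a b f)
    {p : ℝ[X]} (hp : p.Monic) (hdeg : p.natDegree = n) :
    n.factorial * ∫ x in a..b, f x =
      ∑ k ∈ Finset.range n, (-1) ^ k *
        (D k a b f b * (derivative^[n - 1 - k] p).eval b -
          D k a b f a * (derivative^[n - 1 - k] p).eval a) +
      (-1) ^ n * ∫ x in a..b, D n a b f x * p.eval x := by
  have hconst : derivative^[n] p = C (n.factorial : ℝ) := by
    rw [← hdeg, iterate_derivative_natDegree, hp.leadingCoeff, nsmul_one]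
  rw [← integral_mul_iterate_derivative hab.le
    (fun k => hf.absolutelyContinuousOnInterval_D hab) p, hconst]
  simp only [eval_C, intervalIntegral.integral_mul_const, mul_comm]

theorem Admissible.integral_eq_rule_add_errorTerm (hab : a < b) (hf : Admissible n a b f) :
    ∫ x in a..b, f x = rule n a b f + errorTerm n a b f := by
  have hfac : (n.factorial : ℝ) ≠ 0 := by positivity
  have h := hf.factorial_mul_integral_eq_of_monic hab (monic_phiPoly n hab.ne)
    (natDegree_phiPoly n hab.ne)
  simp only [phiPoly_eval] at h
  have hboundary : ∀ k ∈ Finset.range n, (-1) ^ k *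
      (D k a b f b * (derivative^[n - 1 - k] (phiPoly n a b)).eval b -
        D k a b f a * (derivative^[n - 1 - k] (phiPoly n a b)).eval a) =
      (derivative^[n - 1 - k] (phiPoly n a b)).eval b *
        (D k a b f a + (-1) ^ k * D k a b f b) := fun k hk => by
    have hsign : (-1 : ℝ) ^ k * (-1) ^ (n + (n - 1 - k)) = -1 := by
      have := Finset.mem_range.1 hk
      rw [← pow_add]
      exact Odd.neg_one_pow ⟨n - 1, by omega⟩
    rw [iterate_derivative_phiPoly_eval_left]
    linear_combination
      -(D k a b f a * (derivative^[n - 1 - k] (phiPoly n a b)).eval b) * hsign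
  rw [Finset.sum_congr rfl hboundary, Finset.sum_congr rfl fun k hk => by
    rw [iterate_derivative_phiPoly_eval_right hab.ne (Finset.mem_range.1 hk)]] at h
  rw [rule, errorTerm, one_div_mul_eq_div, div_mul_eq_mul_div, ← add_div, eq_div_iff hfac,
    mul_comm, h]

end IntegrationByParts

/-! ### The error estimate and its extremal functions -/

theorem norm_integral_smul_le_eLpNorm_top_mul {α 𝕜 E : Type*} {_ : MeasurableSpace α}
    {μ : Measure α} [NormedField 𝕜] [NormedAddCommGroup E] [NormedSpace ℝ E] [NormedSpace 𝕜 E]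
    {g : α → 𝕜} {φ : α → E} (hg : eLpNorm g ⊤ μ ≠ ⊤) (hφ : Integrable φ μ) :
    ‖∫ x, g x • φ x ∂μ‖ ≤ (eLpNorm g ⊤ μ).toReal * ∫ x, ‖φ x‖ ∂μ := by
  rw [← integral_const_mul]
  refine norm_integral_le_of_norm_le (hφ.norm.const_mul _) ?_
  filter_upwards [ae_le_eLpNormEssSup (f := g) (μ := μ)] with x hx
  rw [norm_smul, ← toReal_enorm (g x)]
  rw [← eLpNorm_exponent_top] at hx
  gcongr

theorem absolutelyContinuousOnInterval_congr {X : Type*} [PseudoMetricSpace X] {f g : ℝ → X}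
    {a b : ℝ} (hfg : Set.EqOn f g (Set.uIcc a b)) :
    AbsolutelyContinuousOnInterval f a b ↔ AbsolutelyContinuousOnInterval g a b := by
  refine Filter.tendsto_congr' ?_
  filter_upwards [Filter.mem_inf_of_right (Filter.mem_principal_self _)] with E hE
  exact Finset.sum_congr rfl fun i hi => by rw [hfg (hE.1 i hi).1, hfg (hE.1 i hi).2]

theorem exists_contDiff_iteratedDeriv_eq {E : Type*} [NormedAddCommGroup E] [NormedSpace ℝ E]
    [CompleteSpace E] (n : ℕ) {g : ℝ → E} (hg : Continuous g) :
    ∃ f : ℝ → E, ContDiff ℝ n f ∧ iteratedDeriv n f = g := by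
  induction n with
  | zero => exact ⟨g, contDiff_zero.2 hg, iteratedDeriv_zero⟩
  | succ n ih =>
    obtain ⟨F, hF, rfl⟩ := ih
    have hderiv (x : ℝ) : HasDerivAt (fun x => ∫ t in (0 : ℝ)..x, F t) (F x) x :=
      hF.continuous.integral_hasStrictDerivAt 0 x |>.hasDerivAt
    have hderiv_eq : deriv (fun x => ∫ t in (0 : ℝ)..x, F t) = F :=
      funext fun x => (hderiv x).deriv
    refine ⟨fun x => ∫ t in (0 : ℝ)..x, F t, ?_, by rw [iteratedDeriv_succ', hderiv_eq]⟩
    push_cast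
    rw [contDiff_succ_iff_deriv, hderiv_eq]
    exact ⟨fun x => (hderiv x).differentiableAt, by simp, hF⟩

section Extremal

variable {n : ℕ} {a b : ℝ}

theorem exists_admissible_D_ae_eq (hn : 1 ≤ n) (hab : a < b) {g : ℝ → ℝ}
    (hg : MemLp g ⊤ (volume.restrict (Set.Icc a b))) :
    ∃ f, Admissible n a b f ∧ D n a b f =ᵐ[volume.restrict (Set.Icc a b)] g := by
  obtain ⟨m, rfl⟩ : ∃ m, n = m + 1 := ⟨n - 1, by omega⟩
  set G : ℝ → ℝ := fun x => ∫ t in a..x, (Set.Icc a b).indicator g t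
  have hint : Integrable ((Set.Icc a b).indicator g) :=
    (integrable_indicator_iff measurableSet_Icc).2 (hg.integrable le_top)
  obtain ⟨f, hf, hfG⟩ := exists_contDiff_iteratedDeriv_eq m (hint.continuous_primitive a)
  have hDm : Set.EqOn (D m a b f) G (Set.Icc a b) := fun x hx => by
    rw [D, iteratedDerivWithin_eq_iteratedDeriv (uniqueDiffOn_Icc hab) hf.contDiffAt hx, hfG]
  have hDn : D (m + 1) a b f =ᵐ[volume.restrict (Set.Icc a b)] g := by
    rw [Filter.EventuallyEq, ae_restrict_iff' measurableSet_Icc]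
    filter_upwards [LocallyIntegrable.ae_hasDerivAt_integral hint.locallyIntegrable] with x hx hxI
    rw [D, iteratedDerivWithin_succ]
    refine (derivWithin_congr hDm (hDm hxI)).trans ?_
    rw [(hx a).hasDerivWithinAt.derivWithin (uniqueDiffOn_Icc hab x hxI),
      Set.indicator_of_mem hxI]
  refine ⟨f, ⟨hf.contDiffOn, ?_, (memLp_congr_ae hDn).2 hg⟩, hDn⟩
  rw [Nat.add_sub_cancel, absolutelyContinuousOnInterval_congr (by rwa [Set.uIcc_of_le hab.le])]
  exact hint.intervalIntegrable.absolutelyContinuousOnInterval_intervalIntegral Set.left_mem_uIcc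

theorem exists_admissible_integral_D_mul_eq_integral_abs (hn : 1 ≤ n) (hab : a < b) {φ : ℝ → ℝ}
    (hφ : Measurable φ) :
    ∃ f, Admissible n a b f ∧ supNormD n a b f = 1 ∧
      ∫ x in a..b, D n a b f x * φ x = ∫ x in a..b, |φ x| := by
  -- Unlike `SignType.sign`, this sign has absolute value `1` even where `φ` vanishes.
  set s : ℝ → ℝ := fun x => if 0 ≤ φ x then 1 else -1
  have hs_norm (x : ℝ) : ‖s x‖ = ‖(1 : ℝ)‖ := by simp only [s]; split_ifs <;> simp
  have hs_mul (x : ℝ) : s x * φ x = |φ x| := by simp only [s]; grind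
  have hs_meas : Measurable s :=
    Measurable.ite (measurableSet_le measurable_const hφ) measurable_const measurable_const
  have hs_memLp : MemLp s ⊤ (volume.restrict (Set.Icc a b)) :=
    memLp_top_of_bound hs_meas.aestronglyMeasurable _ (ae_of_all _ fun x => (hs_norm x).le)
  obtain ⟨f, hf, hD⟩ := exists_admissible_D_ae_eq hn hab hs_memLp
  refine ⟨f, hf, ?_, ?_⟩
  · have hμ : volume.restrict (Set.Icc a b) ≠ 0 := by simp [hab]
    rw [supNormD, eLpNorm_congr_ae hD, eLpNorm_congr_norm_ae (ae_of_all _ hs_norm),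
      eLpNorm_exponent_top, eLpNormEssSup_const _ hμ]
    simp
  · refine intervalIntegral.integral_congr_ae ?_
    rw [Filter.EventuallyEq, ae_restrict_iff' measurableSet_Icc] at hD
    filter_upwards [hD] with x hx hxI
    rw [Set.uIoc_of_le hab.le] at hxI
    rw [hx (Set.Ioc_subset_Icc_self hxI), hs_mul]

theorem abs_errorTerm (f : ℝ → ℝ) :
    |errorTerm n a b f| = |∫ x in a..b, D n a b f x * phi n a b x| / n.factorial := by
  rw [errorTerm, abs_mul, abs_div, abs_neg_one_pow, Nat.abs_cast, one_div_mul_eq_div]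

theorem Admissible.abs_errorTerm_le (hab : a ≤ b) {f : ℝ → ℝ} (hf : Admissible n a b f) :
    |errorTerm n a b f| ≤ (∫ x in a..b, |phi n a b x|) / n.factorial * supNormD n a b f := by
  have h := norm_integral_smul_le_eLpNorm_top_mul hf.memLp.eLpNorm_ne_top
    ((continuous_phi n a b).integrableOn_Icc (μ := volume))
  simp only [smul_eq_mul, Real.norm_eq_abs, integral_Icc_eq_integral_Ioc,
    ← intervalIntegral.integral_of_le hab] at h
  rw [abs_errorTerm, div_mul_eq_mul_div, mul_comm]
  gcongr
  exact h

end Extremal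

end ChebyshevQuadrature

theorem mainTheorem6 (n : ℕ) (hn : 1 ≤ n) (a b : ℝ) (hab : a < b) :
    (∀ f : ℝ → ℝ, ChebyshevQuadrature.Admissible n a b f →
      (∫ x in a..b, f x) =
          ChebyshevQuadrature.rule n a b f + ChebyshevQuadrature.errorTerm n a b f ∧
        |ChebyshevQuadrature.errorTerm n a b f| ≤
          (b - a) ^ (n + 1) / ((2 : ℝ) ^ (2 * n) * (n.factorial : ℝ)) *
            ChebyshevQuadrature.supNormD n a b f) ∧
    (∀ C : ℝ,
      (∀ f : ℝ → ℝ, ChebyshevQuadrature.Admissible n a b f →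
        |ChebyshevQuadrature.errorTerm n a b f| ≤ C * ChebyshevQuadrature.supNormD n a b f) →
      (b - a) ^ (n + 1) / ((2 : ℝ) ^ (2 * n) * (n.factorial : ℝ)) ≤ C) := by
  have hconst : (b - a) ^ (n + 1) / ((2 : ℝ) ^ (2 * n) * (n.factorial : ℝ)) =
      (∫ x in a..b, |ChebyshevQuadrature.phi n a b x|) / n.factorial := by
    rw [ChebyshevQuadrature.integral_abs_phi n hab, div_div]
  rw [hconst]
  refine ⟨fun f hf => ⟨hf.integral_eq_rule_add_errorTerm hab, hf.abs_errorTerm_le hab.le⟩,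
    fun C hC => ?_⟩
  obtain ⟨f, hf, hnorm, hintegral⟩ :=
    ChebyshevQuadrature.exists_admissible_integral_D_mul_eq_integral_abs hn hab
      (ChebyshevQuadrature.continuous_phi n a b).measurable
  calc (∫ x in a..b, |ChebyshevQuadrature.phi n a b x|) / n.factorial
      ≤ |(∫ x in a..b, |ChebyshevQuadrature.phi n a b x|)| / n.factorial := by
        gcongr
        exact le_abs_self _
    _ = |ChebyshevQuadrature.errorTerm n a b f| := by
        rw [ChebyshevQuadrature.abs_errorTerm, hintegral]
    _ ≤ C * ChebyshevQuadrature.supNormD n a b f := hC f hf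
    _ = C := by rw [hnorm, mul_one]
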